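/- Let $d\ge 2$ and let $S^d$ be the unit sphere of $E^{d+1}$, with spherical distance $|ab|=\arccos\langle a,b\rangle$. A convex body on $S^d$ is a closed set $C\subset S^d$ with non-empty interior that contains no pair of antipodes and contains, with any two points $a,b$, the shorter great-circle arc $ab$. The hemisphere with center $m$ is $H(m)=\{x\in S^d: |xm|\le \pi/2\}$; a hemisphere $K$ supports a convex body $C$ if $C\subset K$ and $\mathrm{bd}(C)\cap\mathrm{bd}(K)\neq\emptyset$. A lune is a set $L=G\cap H$, where $G,H$ are hemispheres that are different and not opposite (their centers are not antipodes); it is bounded by the two $(d-1)$-dimensional hemispheres $G/H=\mathrm{bd}(G)\cap H$ and $H/G=\mathrm{bd}(H)\cap G$, where a $(d-1)$-dimensional hemisphere with center $c$ is the set of points at distance at most $\pi/2$ from $c$ in the intersection of $S^d$ with a $d$-dimensional linear subspace containing $c$. The thickness $\Delta(L)$ is the spherical distance between the centers of $G/H$ and $H/G$. If $K$ supports $C$, the width of $C$ determined by $K$ is the minimum of $\Delta(K\cap K')$ over all hemispheres $K'$ supporting $C$ for which $K\cap K'$ is a lune; $C$ is of constant width $w$ if its width determined by $K$ equals $w$ for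 every hemisphere $K$ supporting $C$. Theorem. For every convex body $W\subset S^d$ of constant width $w$ and every boundary point $p$ of $W$ there exists a lune $L\supset W$ with $\Delta(L)=w$ such that $p$ is the center of one of the two $(d-1)$-dimensional hemispheres bounding $L$. -/

import Mathlib

open scoped Real

namespace SphericalBody

/-- The unit sphere `S^d` of the Euclidean space `E^{d+1}`, with the subspace topology. -/
abbrev Sph (d : ℕ) : Type := Metric.sphere (0 : EuclideanSpace ℝ (Fin (d + 1))) 1

variable {d : ℕ}

/-- The spherical distance `|ab|`: the length of the shorter great-circle arc from `a` to `b`. -/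
noncomputable def sdist (a b : Sph d) : ℝ :=
  InnerProductGeometry.angle (a : EuclideanSpace ℝ (Fin (d + 1))) b

/-- The spherical ball `B_ρ(x)`. -/
def sball (x : Sph d) (ρ : ℝ) : Set (Sph d) := {y | sdist y x ≤ ρ}

/-- The hemisphere `H(m)` with center `m`. -/
def hemisphere (m : Sph d) : Set (Sph d) := sball m (π / 2)

def IsHemisphere (G : Set (Sph d)) : Prop := ∃ m : Sph d, G = hemisphere m

/-- Opposite hemispheres: their centers are a pair of antipodes. -/
def AreOpposite (G H : Set (Sph d)) : Prop :=
  ∃ m : Sph d, G = hemisphere m ∧ H = hemisphere (-m)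

/-- The arc `ab` of two points that are not antipodes: the shorter part of the great circle
through them, that is, the points of the sphere in the cone spanned by `a` and `b`
(for `a = b` it is the single point `a`). -/
def arc (a b : Sph d) : Set (Sph d) :=
  {x | ∃ s t : ℝ, 0 ≤ s ∧ 0 ≤ t ∧
    (x : EuclideanSpace ℝ (Fin (d + 1))) =
      s • (a : EuclideanSpace ℝ (Fin (d + 1))) + t • (b : EuclideanSpace ℝ (Fin (d + 1)))}

/-- Spherical convexity: no pair of antipodes, and closed under connecting arcs. -/
def IsSphConvex (C : Set (Sph d)) : Prop :=
  (∀ a ∈ C, -a ∉ C) ∧ ∀ a ∈ C, ∀ b ∈ C, arc a b ⊆ C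

/-- A convex body: a closed convex set with non-empty interior. -/
def IsConvexBody (C : Set (Sph d)) : Prop :=
  IsClosed C ∧ IsSphConvex C ∧ (interior C).Nonempty

/-- The hemisphere `K` supports `C`. -/
def Supports (K C : Set (Sph d)) : Prop :=
  IsHemisphere K ∧ C ⊆ K ∧ (frontier C ∩ frontier K).Nonempty

/-- `G` and `H` are hemispheres, different and not opposite, so that `G ∩ H` is a lune. -/
def FormLune (G H : Set (Sph d)) : Prop :=
  IsHemisphere G ∧ IsHemisphere H ∧ G ≠ H ∧ ¬ AreOpposite G H

/-- `G/H`: the part of the boundary of the lune `G ∩ H` that lies in the boundary of `G`. -/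
def luneFace (G H : Set (Sph d)) : Set (Sph d) := frontier G ∩ H

/-- `A` is a `(d-1)`-dimensional hemisphere with center `c`: for a `(d-1)`-dimensional great
sphere (the trace of a hyper-subspace `V`) through `c`, it is the set of the points of this
great sphere at distance at most `π/2` from `c`. -/
def IsCenter (c : Sph d) (A : Set (Sph d)) : Prop :=
  ∃ V : Submodule ℝ (EuclideanSpace ℝ (Fin (d + 1))), Module.finrank ℝ V = d ∧
    (c : EuclideanSpace ℝ (Fin (d + 1))) ∈ V ∧
    A = {x : Sph d | (x : EuclideanSpace ℝ (Fin (d + 1))) ∈ V ∧ sdist x c ≤ π / 2}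

/-- The lune `G ∩ H` has thickness `t`: the centers of the two `(d-1)`-dimensional hemispheres
bounding it are at spherical distance `t`. -/
def HasThickness (G H : Set (Sph d)) (t : ℝ) : Prop :=
  ∃ a b : Sph d, IsCenter a (luneFace G H) ∧ IsCenter b (luneFace H G) ∧ sdist a b = t

/-- The width of `C` determined by the hemisphere `K` is `w`: the least thickness of a lune
`K ∩ K'` over the hemispheres `K'` supporting `C`. -/
def HasWidth (K C : Set (Sph d)) (w : ℝ) : Prop :=
  IsLeast {t | ∃ K', Supports K' C ∧ FormLune K K' ∧ HasThickness K K' t} w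

/-- `W` is a (spherical convex) body of constant width `w`. -/
def IsBodyOfConstantWidth (W : Set (Sph d)) (w : ℝ) : Prop :=
  IsConvexBody W ∧ ∀ K, Supports K W → HasWidth K W w

/-!
The centers of the hemispheres containing `W` form a convex body `D` whose dual body is `W`, and
the width of `W` determined by a supporting hemisphere `H(g)` is `π` minus the largest distance
from `g` to a point of `D`. Hence `D` has constant diameter `π - w`. If `H(g)` supports `W` at
`p`, then `p` is the center of a side of the lune `H(g) ∩ H(h)` of thickness `w` exactly when `h`
is the point at distance `π - w` from `g` in the direction of `p`, so it remains to show `h ∈ D`.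

If `π - w ≤ π / 2`, then `D` is complete: a point at distance at most `π - w` from all of `D` lies
in `D`. If some `x ∈ D` were too far from `h`, then `g` could be moved a little towards `x` and away
from `p` without leaving `D`, contradicting that `p` belongs to the dual of `D`. If
`π - w > π / 2`, then any two points of `W` are at distance at most `w`. The partner `h'` of `g` at
distance `π - w` gives a point of `W` in the direction of `g - cos (π - w) • h'`, and its
distance to `p` being at most `w` forces `h' = h`.
-/

open Set Filter Topology
open scoped RealInnerProductSpace

section InnerProduct

variable {E : Type*} [NormedAddCommGroup E] [InnerProductSpace ℝ E]

lemma abs_norm_add_sub_one_add_inner_le {g : E} (hg : ‖g‖ = 1) (v : E) :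
    |‖g + v‖ - (1 + ⟪g, v⟫)| ≤ ‖v‖ ^ 2 / 2 := by
  have hsq : ‖g + v‖ ^ 2 = 1 + 2 * ⟪g, v⟫ + ‖v‖ ^ 2 := by
    rw [norm_add_sq_real, hg, one_pow]
  have hCS : 1 + ⟪g, v⟫ ≤ ‖g + v‖ := by
    simpa [inner_add_right, hg] using real_inner_le_norm g (g + v)
  rw [abs_of_nonneg (sub_nonneg.2 hCS)]
  nlinarith [sq_nonneg (‖g + v‖ - 1)]

lemma inner_sub_inner_smul_self {q : E} (hq : ‖q‖ = 1) (z : E) : ⟪q, z - ⟪z, q⟫ • q⟫ = 0 := by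
  simp [inner_sub_right, real_inner_smul_right, hq, real_inner_comm]

lemma norm_sub_inner_smul_sq {q : E} (hq : ‖q‖ = 1) (z : E) :
    ‖z - ⟪z, q⟫ • q‖ ^ 2 = ‖z‖ ^ 2 - ⟪z, q⟫ ^ 2 := by
  rw [norm_sub_sq_real, real_inner_smul_right, norm_smul, hq, mul_one, Real.norm_eq_abs, sq_abs]
  ring

lemma inner_sq_le_mul_norm_sq_of_inner_eq_zero {q u : E} (hq : ‖q‖ = 1) (hqu : ⟪q, u⟫ = 0)
    (z : E) : ⟪z, u⟫ ^ 2 ≤ (‖z‖ ^ 2 - ⟪z, q⟫ ^ 2) * ‖u‖ ^ 2 := by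
  have hinner : ⟪z - ⟪z, q⟫ • q, u⟫ = ⟪z, u⟫ := by
    rw [inner_sub_left, real_inner_smul_left, hqu, mul_zero, sub_zero]
  rw [← hinner, ← norm_sub_inner_smul_sq hq, ← mul_pow]
  exact sq_le_sq.2 (by simpa using abs_real_inner_le_norm (z - ⟪z, q⟫ • q) u)

lemma neg_le_inner_of_inner_sub_smul_eq {p q h : E} (hp : ‖p‖ = 1) (hq : ‖q‖ = 1) (hh : ‖h‖ = 1)
    {c : ℝ} (hc : c < 0) (hph : 0 ≤ ⟪p, h⟫) (hqh : 0 ≤ ⟪q, h⟫) (hpq : p - ⟪p, q⟫ • q ≠ 0)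
    (heq : ⟪p - ⟪p, q⟫ • q, h⟫ = c * ‖p - ⟪p, q⟫ • q‖) : -c ≤ ⟪p, q⟫ := by
  have hqu := inner_sub_inner_smul_self hq p
  have hnorm := norm_sub_inner_smul_sq hq p
  have hsplit : ⟪p - ⟪p, q⟫ • q, h⟫ = ⟪p, h⟫ - ⟪p, q⟫ * ⟪q, h⟫ := by
    rw [inner_sub_left, real_inner_smul_left]
  set u := p - ⟪p, q⟫ • q
  have hu : 0 < ‖u‖ := norm_pos_iff.2 hpq
  have hle : -c * ‖u‖ ≤ ⟪p, q⟫ * ⟪q, h⟫ := by linarith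
  have hpos : 0 < ⟪p, q⟫ := pos_of_mul_pos_left (by nlinarith) hqh
  have hbessel : c ^ 2 ≤ 1 - ⟪q, h⟫ ^ 2 := by
    have := inner_sq_le_mul_norm_sq_of_inner_eq_zero hq hqu h
    rw [real_inner_comm, heq, hh, mul_pow, one_pow, real_inner_comm q] at this
    exact le_of_mul_le_mul_right this (by positivity)
  have hsq := pow_le_pow_left₀ (by nlinarith) hle 2
  rw [mul_pow, hnorm, hp] at hsq
  nlinarith [mul_le_mul_of_nonneg_left hbessel (sq_nonneg ⟪p, q⟫)]

lemma norm_sq_smul_add_smul {g p : E} (hg : ‖g‖ = 1) (hp : ‖p‖ = 1) (hgp : ⟪g, p⟫ = 0)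
    (a b : ℝ) : ‖a • g + b • p‖ ^ 2 = a ^ 2 + b ^ 2 := by
  simp [norm_add_sq_real, real_inner_smul_left, real_inner_smul_right, hgp, norm_smul, hg, hp]

lemma exists_lineMap_mem_frontier {s : Set E} {x y : E} (hx : x ∈ s) (hy : y ∉ s) :
    ∃ t ∈ Icc (0 : ℝ) 1, AffineMap.lineMap x y t ∈ frontier s := by
  let γ : unitInterval → E := fun t => AffineMap.lineMap x y (t : ℝ)
  have hγ : Continuous γ := AffineMap.lineMap_continuous.comp continuous_subtype_val
  have h0 : (0 : unitInterval) ∈ γ ⁻¹' s := by simpa [γ] using hx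
  have h1 : (1 : unitInterval) ∉ γ ⁻¹' s := by simpa [γ] using hy
  obtain ⟨t, ht⟩ := nonempty_frontier_iff.2
    ⟨⟨0, h0⟩, (ne_univ_iff_exists_notMem _).2 ⟨1, h1⟩⟩
  exact ⟨t, t.2, hγ.frontier_preimage_subset s ht⟩

lemma exists_pos_sub_smul_mem_of_mem_interior {s : Set E} {x : E} (hx : x ∈ interior s) (v : E) :
    ∃ ε : ℝ, 0 < ε ∧ x - ε • v ∈ s := by
  have hlim : Tendsto (fun ε : ℝ => x - ε • v) (𝓝[>] 0) (𝓝 x) := by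
    have : Continuous fun ε : ℝ => x - ε • v := by fun_prop
    simpa using (this.tendsto 0).mono_left nhdsWithin_le_nhds
  exact ((eventually_mem_nhdsWithin (s := Ioi (0 : ℝ))).and
    (hlim.eventually (mem_interior_iff_mem_nhds.1 hx))).exists

lemma inner_pos_of_mem_interior {s : Set E} {x a : E} (hx : x ∈ interior s)
    (ha : ∀ y ∈ s, 0 ≤ ⟪y, a⟫) (ha0 : a ≠ 0) : 0 < ⟪x, a⟫ := by
  obtain ⟨ε, hε, hmem⟩ := exists_pos_sub_smul_mem_of_mem_interior hx a
  have hle := ha _ hmem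
  rw [inner_sub_left, real_inner_smul_left, real_inner_self_eq_norm_sq] at hle
  have : 0 < ε * ‖a‖ ^ 2 := by positivity
  linarith

end InnerProduct

section Cone

variable {E : Type*} [NormedAddCommGroup E] [InnerProductSpace ℝ E]

lemma mem_interior_innerDual_iff [CompleteSpace E] {s : Set E} (hs : IsCompact s) (h0 : 0 ∉ s)
    {m : E} :
    m ∈ interior (ProperCone.innerDual s : Set E) ↔ ∀ x ∈ s, 0 < ⟪x, m⟫ := by
  refine ⟨fun hm x hx => ?_, fun hm => ?_⟩
  · rw [real_inner_comm]
    refine inner_pos_of_mem_interior hm (fun y hy => ?_) (ne_of_mem_of_not_mem hx h0)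
    rw [real_inner_comm]
    exact ProperCone.mem_innerDual.1 hy hx
  · have hev : ∀ᶠ m' in 𝓝 m, ∀ x ∈ s, 0 < ⟪x, m'⟫ := by
      refine hs.eventually_forall_of_forall_eventually fun x hx => ?_
      have hopen : IsOpen {q : E × E | 0 < ⟪q.2, q.1⟫} :=
        isOpen_lt continuous_const (by fun_prop)
      exact hopen.mem_nhds (x := (m, x)) (hm x hx)
    exact mem_interior_iff_mem_nhds.2
      (hev.mono fun m' hm' => ProperCone.mem_innerDual.2 fun x hx => (hm' x hx).le)

lemma mem_frontier_innerDual_iff [CompleteSpace E] {s : Set E} (hs : IsCompact s) (h0 : 0 ∉ s)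
    {m : E} :
    m ∈ frontier (ProperCone.innerDual s : Set E) ↔
      m ∈ ProperCone.innerDual s ∧ ∃ x ∈ s, ⟪x, m⟫ = 0 := by
  rw [(ProperCone.innerDual s).isClosed.frontier_eq, Set.mem_sdiff,
    mem_interior_innerDual_iff hs h0]
  refine and_congr_right fun hm => ?_
  push Not
  exact exists_congr fun x => and_congr_right fun hx =>
    ⟨fun h => h.antisymm (ProperCone.mem_innerDual.1 hm hx), fun h => h.le⟩

lemma nonempty_interior_innerDual [FiniteDimensional ℝ E] (C : ProperCone ℝ E)
    (hC : ∀ a ∈ C, -a ∈ C → a = 0) :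
    (interior (ProperCone.innerDual (C : Set E) : Set E)).Nonempty := by
  set D := ProperCone.innerDual (C : Set E)
  have hspan : Submodule.span ℝ (D : Set E) = ⊤ := by
    rw [← Submodule.orthogonal_eq_bot_iff, Submodule.eq_bot_iff]
    intro v hv
    have hv0 : ∀ y ∈ D, ⟪y, v⟫ = 0 := fun y hy =>
      (Submodule.mem_orthogonal _ v).1 hv y (Submodule.subset_span hy)
    refine hC v ?_ ?_ <;> rw [← ProperCone.innerDual_innerDual C] <;>
      exact ProperCone.mem_innerDual.2 fun y hy => by simp [hv0 y hy]
  rw [D.convex.interior_nonempty_iff_affineSpan_eq_top,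
    AffineSubspace.affineSpan_eq_top_iff_vectorSpan_eq_top_of_nonempty _ _ _ D.nonempty,
    vectorSpan_eq_span_vsub_set_right ℝ (show (0 : E) ∈ (D : Set E) from D.zero_mem)]
  simpa using hspan

lemma exists_sub_smul_mem_frontier {D : ProperCone ℝ E} {k k' : E} (hk : -k ∉ D) (hk' : k' ∈ D) :
    ∃ ε : ℝ, 0 ≤ ε ∧ k' - ε • k ∈ frontier (D : Set E) := by
  obtain ⟨N, hN0, hN⟩ : ∃ N : ℝ, 0 ≤ N ∧ k' - N • k ∉ D := by
    by_contra! hall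
    have hlim : Tendsto (fun N : ℝ => N⁻¹ • k' - k) atTop (𝓝 (-k)) := by
      simpa using ((tendsto_inv_atTop_zero (𝕜 := ℝ)).smul_const k').sub_const k
    refine hk (D.isClosed.mem_of_tendsto hlim ?_)
    filter_upwards [eventually_gt_atTop 0] with N hN
    simpa [smul_sub, smul_smul, hN.ne'] using D.smul_mem (hall N hN.le) (inv_nonneg.2 hN.le)
  obtain ⟨t, ht, hmem⟩ := exists_lineMap_mem_frontier (s := (D : Set E)) hk' hN
  refine ⟨t * N, mul_nonneg ht.1 hN0, ?_⟩
  convert hmem using 1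
  rw [AffineMap.lineMap_apply_module']
  module

lemma le_inner_of_forall_mem_frontier {D : ProperCone ℝ E} {c : ℝ} (hc : |c| ≤ 1) {k : E}
    (hk : -k ∉ D) (hfr : ∀ u ∈ frontier (D : Set E), c * (‖k‖ * ‖u‖) ≤ ⟪k, u⟫)
    {k' : E} (hk' : k' ∈ D) : c * (‖k‖ * ‖k'‖) ≤ ⟪k, k'⟫ := by
  obtain ⟨ε, hε, hu⟩ := exists_sub_smul_mem_frontier hk hk'
  have hdiff : |c * (‖k'‖ - ‖k' - ε • k‖)| ≤ ε * ‖k‖ := by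
    have := abs_norm_sub_norm_le k' (k' - ε • k)
    rw [sub_sub_cancel, norm_smul, Real.norm_of_nonneg hε] at this
    rw [abs_mul]
    exact (mul_le_of_le_one_left (abs_nonneg _) hc).trans this
  have hle := hfr _ hu
  rw [inner_sub_right, real_inner_smul_right, real_inner_self_eq_norm_sq] at hle
  nlinarith [mul_le_mul_of_nonneg_left (le_of_abs_le hdiff) (norm_nonneg k)]

lemma sub_smul_mem_innerDual_of_inner_eq [CompleteSpace E] {D : ProperCone ℝ E} {c : ℝ} {g h : E}
    (hg : ∀ y ∈ D, c * ‖y‖ ≤ ⟪g, y⟫) (hh : h ∈ D) (hh1 : ‖h‖ = 1) (hgh : ⟪g, h⟫ = c) :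
    g - c • h ∈ ProperCone.innerDual (D : Set E) := by
  -- `h` minimizes `⟪g, y⟫ - c * ‖y‖` over `y ∈ D`, and `g - c • h` is the gradient at `h`.
  refine ProperCone.mem_innerDual.2 fun y hy => ?_
  have hstep : ∀ ε : ℝ, 0 < ε → -(|c| * (‖y‖ ^ 2 / 2)) * ε ≤ ⟪y, g - c • h⟫ := by
    intro ε hε
    have hle := hg _ (add_mem hh (D.smul_mem hy hε.le))
    have hnorm : |c * (‖h + ε • y‖ - (1 + ⟪h, ε • y⟫))| ≤ |c| * (‖ε • y‖ ^ 2 / 2) := by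
      rw [abs_mul]
      exact mul_le_mul_of_nonneg_left (abs_norm_add_sub_one_add_inner_le hh1 _) (abs_nonneg c)
    have hnorm' := neg_le_of_abs_le hnorm
    simp only [inner_add_right, real_inner_smul_right, norm_smul, Real.norm_of_nonneg hε.le,
      hgh] at hle hnorm'
    rw [inner_sub_right, real_inner_smul_right, real_inner_comm, real_inner_comm h]
    refine le_of_mul_le_mul_left ?_ hε
    linarith
  have hlim : Tendsto (fun ε : ℝ => -(|c| * (‖y‖ ^ 2 / 2)) * ε) (𝓝[>] 0) (𝓝 0) := by
    have : Continuous fun ε : ℝ => -(|c| * (‖y‖ ^ 2 / 2)) * ε := by fun_prop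
    simpa using (this.tendsto 0).mono_left nhdsWithin_le_nhds
  exact le_of_tendsto hlim (eventually_mem_nhdsWithin.mono fun ε hε => hstep ε hε)

lemma innerDual_inter_sphere [CompleteSpace E] (D : ProperCone ℝ E) :
    ProperCone.innerDual ((D : Set E) ∩ Metric.sphere 0 1) = ProperCone.innerDual (D : Set E) := by
  refine le_antisymm (fun y hy => ProperCone.mem_innerDual.2 fun x hx => ?_)
    (ProperCone.innerDual_le_innerDual inter_subset_left)
  rcases eq_or_ne x 0 with rfl | hx0
  · simp
  have hmem : ‖x‖⁻¹ • x ∈ (D : Set E) ∩ Metric.sphere 0 1 :=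
    ⟨D.smul_mem hx (by positivity), by simp [norm_smul, hx0]⟩
  have hle := ProperCone.mem_innerDual.1 hy hmem
  rw [real_inner_smul_left] at hle
  exact nonneg_of_mul_nonneg_right hle (by positivity)

lemma mem_frontier_of_inner_eq_zero [CompleteSpace E] {D : ProperCone ℝ E} {x a : E} (hx : x ∈ D)
    (ha : a ∈ ProperCone.innerDual (D : Set E)) (ha0 : a ≠ 0) (hxa : ⟪x, a⟫ = 0) :
    x ∈ frontier (D : Set E) := by
  rw [D.isClosed.frontier_eq]
  exact ⟨hx, fun hint =>
    (inner_pos_of_mem_interior hint (fun _ hy => ProperCone.mem_innerDual.1 ha hy) ha0).ne' hxa⟩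

lemma sub_inner_smul_mem_frontier [CompleteSpace E] {D : ProperCone ℝ E} {p q : E}
    (hq : q ∈ ProperCone.innerDual (D : Set E)) (hq1 : ‖q‖ = 1)
    (hmin : ∀ a ∈ ProperCone.innerDual (D : Set E), ⟪p, q⟫ * ‖a‖ ≤ ⟪p, a⟫) :
    p - ⟪p, q⟫ • q ∈ frontier (D : Set E) := by
  refine mem_frontier_of_inner_eq_zero ?_ hq (norm_ne_zero_iff.1 (by simp [hq1])) ?_
  · rw [← ProperCone.innerDual_innerDual D]
    exact sub_smul_mem_innerDual_of_inner_eq hmin hq hq1 rfl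
  · simp [inner_sub_left, real_inner_smul_left, hq1]

lemma exists_forall_inner_mul_norm_le [FiniteDimensional ℝ E] {C : ProperCone ℝ E} {p : E}
    (hp : p ∈ C) (hp1 : ‖p‖ = 1) : ∃ q ∈ C, ‖q‖ = 1 ∧ ∀ a ∈ C, ⟪p, q⟫ * ‖a‖ ≤ ⟪p, a⟫ := by
  obtain ⟨q, ⟨hq, hq1⟩, hmin⟩ :=
    ((isCompact_sphere (0 : E) 1).inter_left C.isClosed).exists_isMinOn
      ⟨p, hp, mem_sphere_zero_iff_norm.2 hp1⟩
      (show ContinuousOn (fun a => ⟪p, a⟫) _ by fun_prop)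
  refine ⟨q, hq, mem_sphere_zero_iff_norm.1 hq1, fun a ha => ?_⟩
  rcases eq_or_ne a 0 with rfl | ha0
  · simp
  have hle : ⟪p, q⟫ ≤ ⟪p, ‖a‖⁻¹ • a⟫ := hmin
    ⟨C.smul_mem ha (by positivity), by simp [norm_smul, ha0]⟩
  rwa [real_inner_smul_right, ← div_eq_inv_mul, le_div_iff₀ (norm_pos_iff.2 ha0)] at hle

end Cone


section ConstantDiameter

variable {E : Type*} [NormedAddCommGroup E] [InnerProductSpace ℝ E]

/-- The closed convex cone over a body of constant diameter `arccos c` on the unit sphere: no two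
of its unit vectors make an angle greater than `arccos c`, and every boundary ray makes exactly
this angle with some ray of the cone. Both conditions are stated homogeneously, for vectors of
arbitrary norm. -/
structure IsConeOfConstantDiameter (D : ProperCone ℝ E) (c : ℝ) : Prop where
  nonempty_interior : (interior (D : Set E)).Nonempty
  le_inner : ∀ x ∈ D, ∀ y ∈ D, c * (‖x‖ * ‖y‖) ≤ ⟪x, y⟫
  exists_inner_eq : ∀ x ∈ frontier (D : Set E), ∃ y ∈ D, ‖y‖ = 1 ∧ ⟪x, y⟫ = c * ‖x‖

namespace IsConeOfConstantDiameter

variable {D : ProperCone ℝ E} {c : ℝ}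

lemma lt_inner_of_mem_interior (hD : IsConeOfConstantDiameter D c) (hc0 : 0 ≤ c) (hc1 : c < 1)
    {z k : E} (hz : z ∈ interior (D : Set E)) (hk : k ∈ D) (hk1 : ‖k‖ = 1) :
    c * ‖z‖ < ⟪z, k⟫ := by
  obtain ⟨ε, hε, hmem⟩ := exists_pos_sub_smul_mem_of_mem_interior hz k
  have hle := hD.le_inner _ hmem k hk
  rw [inner_sub_left, real_inner_smul_left, real_inner_self_eq_norm_sq, hk1] at hle
  have hnorm : ‖z‖ ≤ ‖z - ε • k‖ + ε := by
    simpa [norm_smul, hk1, abs_of_pos hε] using norm_add_le (z - ε • k) (ε • k)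
  nlinarith [mul_le_mul_of_nonneg_left hnorm hc0]

lemma mem_of_forall_le_inner (hD : IsConeOfConstantDiameter D c) (hc0 : 0 ≤ c) (hc1 : c < 1)
    {y : E} (hy : ∀ x ∈ D, c * (‖x‖ * ‖y‖) ≤ ⟪x, y⟫) : y ∈ D := by
  by_contra hyD
  obtain ⟨z, hz⟩ := hD.nonempty_interior
  obtain ⟨s, ⟨hs0, hs1⟩, hu⟩ := exists_lineMap_mem_frontier (interior_subset hz) hyD
  obtain ⟨k, hk, hk1, hku⟩ := hD.exists_inner_eq _ hu
  rw [AffineMap.lineMap_apply_module, inner_add_left, real_inner_smul_left,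
    real_inner_smul_left] at hku
  have hs : s < 1 := hs1.lt_of_ne fun h => hyD <| by
    simpa [h] using D.isClosed.frontier_subset hu
  have hzk := hD.lt_inner_of_mem_interior hc0 hc1 hz hk hk1
  have hyk : c * ‖y‖ ≤ ⟪y, k⟫ := by simpa [hk1, real_inner_comm] using hy k hk
  have hnorm : ‖(1 - s) • z + s • y‖ ≤ (1 - s) * ‖z‖ + s * ‖y‖ := by
    simpa [norm_smul, abs_of_nonneg hs0, abs_of_pos (sub_pos.2 hs)] using
      norm_add_le ((1 - s) • z) (s • y)
  linarith [mul_lt_mul_of_pos_left hzk (sub_pos.2 hs), mul_le_mul_of_nonneg_left hyk hs0,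
    mul_le_mul_of_nonneg_left hnorm hc0]

variable {g p : E} {S : ℝ}

lemma inner_le_mul_norm (hD : IsConeOfConstantDiameter D c) (hc0 : 0 ≤ c) (hS : 0 < S)
    (hcS : c ^ 2 + S ^ 2 = 1) (hg : g ∈ D) (hg1 : ‖g‖ = 1) (hp1 : ‖p‖ = 1) (hgp : ⟪g, p⟫ = 0)
    {z : E} (hz : z ∈ D) : ⟪z, p⟫ ≤ S * ‖z‖ := by
  have hzg : c * ‖z‖ ≤ ⟪z, g⟫ := by simpa [hg1] using hD.le_inner z hz g hg
  have hbessel := inner_sq_le_mul_norm_sq_of_inner_eq_zero hg1 hgp z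
  rw [hp1, one_pow, mul_one] at hbessel
  refine le_of_sq_le_sq ?_ (by positivity)
  have := pow_le_pow_left₀ (by positivity) hzg 2
  linear_combination hbessel + this - ‖z‖ ^ 2 * hcS

lemma exists_pos_add_smul_mem (hD : IsConeOfConstantDiameter D c) (hc0 : 0 ≤ c) (hS : 0 < S)
    (hcS : c ^ 2 + S ^ 2 = 1) (hg : g ∈ D) (hg1 : ‖g‖ = 1) (hp1 : ‖p‖ = 1) (hgp : ⟪g, p⟫ = 0)
    {x : E} (hx : x ∈ D) {s : ℝ} (hs0 : 0 ≤ s) (hs : s * S < c * (‖x‖ - ⟪x, g⟫)) :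
    ∃ t : ℝ, 0 < t ∧ g + t • (x - ‖x‖ • g - s • p) ∈ D := by
  set v := x - ‖x‖ • g - s • p with hv
  have hsmall : ∀ᶠ t : ℝ in 𝓝[>] 0,
      t * ‖x‖ < 1 ∧ t * (c * ‖v‖ ^ 2 / 2) < c * (‖x‖ - ⟪x, g⟫) - s * S := by
    have hlim : ∀ r : ℝ, Tendsto (fun t => t * r) (𝓝[>] 0) (𝓝 0) := fun r => by
      simpa using ((continuous_mul_const r).tendsto 0).mono_left nhdsWithin_le_nhds
    exact ((hlim _).eventually_lt_const one_pos).and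
      ((hlim _).eventually_lt_const (sub_pos.2 hs))
  obtain ⟨t, ht0, htx, htv⟩ := (eventually_mem_nhdsWithin.and hsmall).exists
  rw [mem_Ioi] at ht0
  refine ⟨t, ht0, hD.mem_of_forall_le_inner hc0 (by nlinarith) fun z hz => ?_⟩
  have hnorm : ‖g + t • v‖ ≤ 1 - t * (‖x‖ - ⟪x, g⟫) + t ^ 2 * ‖v‖ ^ 2 / 2 := by
    have := le_of_abs_le (abs_norm_add_sub_one_add_inner_le hg1 (t • v))
    simp only [hv, inner_smul_right, inner_sub_right, real_inner_self_eq_norm_sq, hg1, hgp,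
      norm_smul, Real.norm_of_nonneg ht0.le, real_inner_comm x g] at this ⊢
    linarith
  have hle : c * ‖g + t • v‖ ≤ c - t * (s * S) := by
    nlinarith [mul_le_mul_of_nonneg_left hnorm hc0, mul_lt_mul_of_pos_left htv ht0]
  have hzg : c * ‖z‖ ≤ ⟪z, g⟫ := by simpa [hg1] using hD.le_inner z hz g hg
  have hzp := hD.inner_le_mul_norm hc0 hS hcS hg hg1 hp1 hgp hz
  calc c * (‖z‖ * ‖g + t • v‖) = c * ‖g + t • v‖ * ‖z‖ := by ring
    _ ≤ (c - t * (s * S)) * ‖z‖ := by gcongr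
    _ = (1 - t * ‖x‖) * (c * ‖z‖) + t * (c * (‖z‖ * ‖x‖)) - t * s * (S * ‖z‖) := by ring
    _ ≤ (1 - t * ‖x‖) * ⟪z, g⟫ + t * ⟪z, x⟫ - t * s * ⟪z, p⟫ := by
      gcongr
      exact hD.le_inner z hz x hx
    _ = ⟪z, g + t • v⟫ := by
      simp only [hv, inner_add_right, inner_smul_right, inner_sub_right]
      ring

lemma smul_add_smul_mem_of_nonneg [CompleteSpace E] (hD : IsConeOfConstantDiameter D c)
    (hc0 : 0 ≤ c) (hS : 0 < S) (hcS : c ^ 2 + S ^ 2 = 1) (hg : g ∈ D) (hg1 : ‖g‖ = 1)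
    (hp : p ∈ ProperCone.innerDual (D : Set E)) (hp1 : ‖p‖ = 1) (hgp : ⟪g, p⟫ = 0) :
    c • g + S • p ∈ D := by
  have hh1 : ‖c • g + S • p‖ = 1 := by
    rw [← pow_eq_one_iff_of_nonneg (norm_nonneg _) two_ne_zero,
      norm_sq_smul_add_smul hg1 hp1 hgp, hcS]
  refine hD.mem_of_forall_le_inner hc0 (by nlinarith) fun x hx => ?_
  rw [hh1, mul_one, inner_add_right, real_inner_smul_right, real_inner_smul_right]
  by_contra! hlt
  have hxp : 0 ≤ ⟪x, p⟫ := ProperCone.mem_innerDual.1 hp hx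
  obtain ⟨s, hps, hs⟩ := exists_between ((lt_div_iff₀ hS).2
    (show ⟪x, p⟫ * S < c * (‖x‖ - ⟪x, g⟫) by linarith))
  obtain ⟨t, ht, hmem⟩ := hD.exists_pos_add_smul_mem hc0 hS hcS hg hg1 hp1 hgp hx
    (hxp.trans hps.le) ((lt_div_iff₀ hS).1 hs)
  have hneg := ProperCone.mem_innerDual.1 hp hmem
  simp only [inner_add_left, real_inner_smul_left, inner_sub_left, hgp,
    real_inner_self_eq_norm_sq, hp1] at hneg
  nlinarith

lemma neg_mul_norm_le_inner [FiniteDimensional ℝ E] (hD : IsConeOfConstantDiameter D c)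
    (hc1 : -1 ≤ c) (hc0 : c < 0) (hp : p ∈ ProperCone.innerDual (D : Set E)) (hp1 : ‖p‖ = 1) {a : E}
    (ha : a ∈ ProperCone.innerDual (D : Set E)) : -c * ‖a‖ ≤ ⟪p, a⟫ := by
  obtain ⟨q, hq, hq1, hmin⟩ := exists_forall_inner_mul_norm_le hp hp1
  refine (mul_le_mul_of_nonneg_right ?_ (norm_nonneg a)).trans (hmin a ha)
  obtain ⟨h, hh, hh1, huh⟩ := hD.exists_inner_eq _ (sub_inner_smul_mem_frontier hq hq1 hmin)
  rcases eq_or_ne (p - ⟪p, q⟫ • q) 0 with hu | hu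
  · obtain ⟨z, hz⟩ := hD.nonempty_interior
    have hpos : ∀ b ∈ ProperCone.innerDual (D : Set E), ‖b‖ = 1 → 0 < ⟪z, b⟫ := fun b hb hb1 =>
      inner_pos_of_mem_interior hz (fun _ hy => ProperCone.mem_innerDual.1 hb hy)
        (norm_ne_zero_iff.1 (by simp [hb1]))
    have hzp := hpos p hp hp1
    rw [sub_eq_zero.1 hu, real_inner_smul_right] at hzp
    have hpq : 0 < ⟪p, q⟫ := pos_of_mul_pos_left hzp (hpos q hq hq1).le
    have hnorm := norm_sub_inner_smul_sq hq1 p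
    rw [hu, norm_zero, hp1] at hnorm
    nlinarith
  · refine neg_le_inner_of_inner_sub_smul_eq hp1 hq1 hh1 hc0 ?_ ?_ hu huh <;> rw [real_inner_comm]
    exacts [ProperCone.mem_innerDual.1 hp hh, ProperCone.mem_innerDual.1 hq hh]

lemma smul_add_smul_mem_of_neg [FiniteDimensional ℝ E] (hD : IsConeOfConstantDiameter D c)
    (hc0 : c < 0) (hS : 0 < S) (hcS : c ^ 2 + S ^ 2 = 1) (hg : g ∈ D) (hg1 : ‖g‖ = 1)
    (hp : p ∈ ProperCone.innerDual (D : Set E)) (hp1 : ‖p‖ = 1) (hgp : ⟪g, p⟫ = 0) :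
    c • g + S • p ∈ D := by
  obtain ⟨h, hh, hh1, hgh⟩ := hD.exists_inner_eq g
    (mem_frontier_of_inner_eq_zero hg hp (norm_ne_zero_iff.1 (by simp [hp1])) hgp)
  rw [hg1, mul_one] at hgh
  have hq : g - c • h ∈ ProperCone.innerDual (D : Set E) :=
    sub_smul_mem_innerDual_of_inner_eq (fun y hy => by simpa [hg1] using hD.le_inner g hg y hy)
      hh hh1 hgh
  have hq_norm : ‖g - c • h‖ = S := by
    rw [← sq_eq_sq₀ (norm_nonneg _) hS.le, ← hgh, norm_sub_inner_smul_sq hh1, hgh, hg1]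
    linarith
  have hph : S ≤ ⟪h, p⟫ := by
    have hle := hD.neg_mul_norm_le_inner (by nlinarith) hc0 hp hp1 hq
    rw [hq_norm, inner_sub_right, real_inner_smul_right, real_inner_comm, hgp,
      real_inner_comm h p] at hle
    nlinarith
  have hdist : ‖h - (c • g + S • p)‖ ^ 2 ≤ 0 := by
    rw [norm_sub_sq_real, norm_sq_smul_add_smul hg1 hp1 hgp, hcS, hh1, inner_add_right,
      real_inner_smul_right, real_inner_smul_right, real_inner_comm, hgh]
    nlinarith
  rwa [← sub_eq_zero.1 (norm_eq_zero.1 (pow_eq_zero_iff two_ne_zero |>.1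
    (hdist.antisymm (sq_nonneg _))))]

lemma smul_add_smul_mem [FiniteDimensional ℝ E] (hD : IsConeOfConstantDiameter D c)
    (hS : 0 < S) (hcS : c ^ 2 + S ^ 2 = 1) (hg : g ∈ D) (hg1 : ‖g‖ = 1)
    (hp : p ∈ ProperCone.innerDual (D : Set E)) (hp1 : ‖p‖ = 1) (hgp : ⟪g, p⟫ = 0) :
    c • g + S • p ∈ D :=
  (lt_or_ge c 0).elim (fun hc => hD.smul_add_smul_mem_of_neg hc hS hcS hg hg1 hp hp1 hgp)
    fun hc => hD.smul_add_smul_mem_of_nonneg hc hS hcS hg hg1 hp hp1 hgp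

end IsConeOfConstantDiameter

end ConstantDiameter

section Sphere

lemma exists_eq_norm_smul_coe {v : EuclideanSpace ℝ (Fin (d + 1))} (hv : v ≠ 0) :
    ∃ x : Sph d, v = ‖v‖ • x.1 :=
  ⟨⟨NormedSpace.normalize v, by simp [hv]⟩, (NormedSpace.norm_smul_normalize v).symm⟩

lemma inner_eq_cos_sdist (x y : Sph d) : ⟪x.1, y.1⟫ = Real.cos (sdist x y) := by
  simp [sdist, InnerProductGeometry.cos_angle]

lemma sdist_mem_Icc (x y : Sph d) : sdist x y ∈ Icc 0 π :=
  ⟨InnerProductGeometry.angle_nonneg _ _, InnerProductGeometry.angle_le_pi _ _⟩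

lemma sdist_eq_of_inner_eq_cos {x y : Sph d} {θ : ℝ} (hθ : θ ∈ Icc 0 π)
    (h : ⟪x.1, y.1⟫ = Real.cos θ) : sdist x y = θ :=
  Real.injOn_cos (sdist_mem_Icc x y) hθ ((inner_eq_cos_sdist x y).symm.trans h)

lemma sdist_comm (x y : Sph d) : sdist x y = sdist y x :=
  InnerProductGeometry.angle_comm _ _

lemma sdist_eq_zero_iff {x y : Sph d} : sdist x y = 0 ↔ x = y := by
  rw [← Subtype.coe_inj, ← inner_eq_one_iff_of_norm_eq_one (𝕜 := ℝ) (norm_eq_of_mem_sphere x)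
    (norm_eq_of_mem_sphere y)]
  exact ⟨fun h => by rw [inner_eq_cos_sdist, h, Real.cos_zero],
    fun h => sdist_eq_of_inner_eq_cos ⟨le_rfl, Real.pi_nonneg⟩ (h.trans Real.cos_zero.symm)⟩

lemma sdist_eq_pi_iff {x y : Sph d} : sdist x y = π ↔ y = -x := by
  have hneg : sdist (-x) y = π - sdist x y := InnerProductGeometry.angle_neg_left _ _
  rw [eq_comm (a := y), ← sdist_eq_zero_iff, hneg, sub_eq_zero, eq_comm]

/-- The point at signed distance `θ` from `x` on the great circle that leaves `x` in the
direction `u`. -/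
noncomputable def geodesic (x u : Sph d) (hxu : ⟪x.1, u.1⟫ = 0) (θ : ℝ) : Sph d :=
  ⟨Real.cos θ • x.1 + Real.sin θ • u.1, by
    rw [mem_sphere_zero_iff_norm, ← pow_eq_one_iff_of_nonneg (norm_nonneg _) two_ne_zero,
      norm_sq_smul_add_smul (norm_eq_of_mem_sphere x) (norm_eq_of_mem_sphere u) hxu,
      Real.cos_sq_add_sin_sq]⟩

lemma inner_geodesic (x u y : Sph d) (hxu : ⟪x.1, u.1⟫ = 0) (θ : ℝ) :
    ⟪y.1, (geodesic x u hxu θ).1⟫ = Real.cos θ * ⟪y.1, x.1⟫ + Real.sin θ * ⟪y.1, u.1⟫ := by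
  simp only [geodesic, inner_add_right, real_inner_smul_right]

lemma sdist_geodesic {x u : Sph d} (hxu : ⟪x.1, u.1⟫ = 0) {θ : ℝ} (hθ : θ ∈ Icc 0 π) :
    sdist x (geodesic x u hxu θ) = θ :=
  sdist_eq_of_inner_eq_cos hθ (by rw [inner_geodesic, hxu]; simp)

lemma exists_eq_geodesic {x y : Sph d} (hxy : sdist x y ∈ Ioo 0 π) :
    ∃ (u : Sph d) (hxu : ⟪x.1, u.1⟫ = 0), y = geodesic x u hxu (sdist x y) := by
  have hsin : 0 < Real.sin (sdist x y) := Real.sin_pos_of_mem_Ioo hxy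
  set v := y.1 - ⟪y.1, x.1⟫ • x.1 with hv
  have hv_norm : ‖v‖ = Real.sin (sdist x y) := by
    rw [← sq_eq_sq₀ (norm_nonneg _) hsin.le, hv, norm_sub_inner_smul_sq (norm_eq_of_mem_sphere x),
      norm_eq_of_mem_sphere, real_inner_comm, inner_eq_cos_sdist, Real.sin_sq, one_pow]
  obtain ⟨u, hu⟩ := exists_eq_norm_smul_coe (norm_pos_iff.1 (hv_norm ▸ hsin))
  refine ⟨u, ?_, ?_⟩
  · have hxv := inner_sub_inner_smul_self (norm_eq_of_mem_sphere x) y.1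
    rw [← hv, hu, real_inner_smul_right, hv_norm] at hxv
    exact (mul_eq_zero.1 hxv).resolve_left hsin.ne'
  · refine Subtype.ext ?_
    change y.1 = Real.cos (sdist x y) • x.1 + Real.sin (sdist x y) • u.1
    rw [← hv_norm, ← hu, hv, real_inner_comm, inner_eq_cos_sdist, add_sub_cancel]

lemma exists_inner_neg_of_mem_interior {U : Set (Sph d)} {x n : Sph d} (hx : x ∈ interior U)
    (hxn : ⟪x.1, n.1⟫ = 0) : ∃ y ∈ U, ⟪y.1, n.1⟫ < 0 := by
  have hcont : Continuous (geodesic x n hxn) :=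
    Continuous.subtype_mk (by fun_prop) _
  have hzero : geodesic x n hxn 0 = x := Subtype.ext (by simp [geodesic])
  have hmem : ∀ᶠ θ in 𝓝[<] 0, geodesic x n hxn θ ∈ U :=
    ((hcont.tendsto' 0 x hzero).mono_left nhdsWithin_le_nhds).eventually
      (mem_interior_iff_mem_nhds.1 hx)
  obtain ⟨θ, hθU, hθ⟩ :=
    (hmem.and (Ioo_mem_nhdsLT (neg_lt_zero.2 Real.pi_pos))).exists
  refine ⟨_, hθU, ?_⟩
  rw [real_inner_comm, inner_geodesic, real_inner_comm, hxn, real_inner_self_eq_norm_sq,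
    norm_eq_of_mem_sphere]
  simpa using Real.sin_neg_of_neg_of_neg_pi_lt hθ.2 hθ.1

lemma inner_pos_of_mem_interior_sph {U : Set (Sph d)} {x n : Sph d} (hx : x ∈ interior U)
    (hn : ∀ y ∈ U, 0 ≤ ⟪y.1, n.1⟫) : 0 < ⟪x.1, n.1⟫ := by
  refine (hn x (interior_subset hx)).lt_of_ne' fun hxn => ?_
  obtain ⟨y, hyU, hy⟩ := exists_inner_neg_of_mem_interior hx hxn
  exact hy.not_ge (hn y hyU)

lemma eq_of_forall_inner_nonneg {V : Submodule ℝ (EuclideanSpace ℝ (Fin (d + 1)))} {m n : Sph d}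
    (hm : m.1 ∈ V) (hn : n.1 ∈ V) (h : ∀ x : Sph d, x.1 ∈ V → 0 ≤ ⟪x.1, m.1⟫ → 0 ≤ ⟪x.1, n.1⟫) :
    m = n := by
  by_contra hmn
  have hsub : m.1 - n.1 ≠ 0 := sub_ne_zero.2 (Subtype.coe_injective.ne hmn)
  have hlt : ⟪m.1, n.1⟫ < 1 := inner_lt_one_iff_real_of_norm_eq_one (norm_eq_of_mem_sphere m)
    (norm_eq_of_mem_sphere n) |>.2 (Subtype.coe_injective.ne hmn)
  obtain ⟨x, hx⟩ := exists_eq_norm_smul_coe hsub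
  have hpos : 0 < ‖m.1 - n.1‖ := norm_pos_iff.2 hsub
  have hxV : x.1 ∈ V := (V.smul_mem_iff hpos.ne').1 (hx ▸ V.sub_mem hm hn)
  have hxm : ‖m.1 - n.1‖ * ⟪x.1, m.1⟫ = 1 - ⟪m.1, n.1⟫ := by
    rw [← real_inner_smul_left, ← hx, inner_sub_left, real_inner_self_eq_norm_sq,
      norm_eq_of_mem_sphere, one_pow, real_inner_comm]
  have hxn : ‖m.1 - n.1‖ * ⟪x.1, n.1⟫ = ⟪m.1, n.1⟫ - 1 := by
    rw [← real_inner_smul_left, ← hx, inner_sub_left, real_inner_self_eq_norm_sq,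
      norm_eq_of_mem_sphere, one_pow]
  have := h x hxV (nonneg_of_mul_nonneg_right (by linarith) hpos)
  nlinarith

end Sphere

section Lune

lemma mem_hemisphere {x m : Sph d} : x ∈ hemisphere m ↔ 0 ≤ ⟪x.1, m.1⟫ := by
  change Real.arccos _ ≤ π / 2 ↔ _
  simp [Real.arccos_le_pi_div_two]

lemma mem_frontier_hemisphere {x m : Sph d} : x ∈ frontier (hemisphere m) ↔ ⟪x.1, m.1⟫ = 0 := by
  have hset : hemisphere m = {y : Sph d | 0 ≤ ⟪y.1, m.1⟫} := ext fun _ => mem_hemisphere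
  have hcont : Continuous fun y : Sph d => ⟪y.1, m.1⟫ := by fun_prop
  refine ⟨fun hx => ?_, fun hx => ?_⟩
  · rw [hset] at hx
    exact (frontier_le_subset_eq continuous_const hcont hx).symm
  · refine ⟨subset_closure (mem_hemisphere.2 hx.ge), fun hint => ?_⟩
    exact (inner_pos_of_mem_interior_sph hint fun _ => mem_hemisphere.1).ne' hx

lemma hemisphere_injective : Function.Injective (hemisphere : Sph d → Set (Sph d)) :=
  fun _ _ hmn => eq_of_forall_inner_nonneg (V := ⊤) trivial trivial fun _ _ hx =>
    mem_hemisphere.1 (hmn ▸ mem_hemisphere.2 hx)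

lemma formLune_hemisphere_iff {g h : Sph d} :
    FormLune (hemisphere g) (hemisphere h) ↔ sdist g h ∈ Ioo 0 π := by
  have hopp : AreOpposite (hemisphere g) (hemisphere h) ↔ h = -g := by
    constructor
    · rintro ⟨m, hg, hh⟩
      rw [hemisphere_injective hg, hemisphere_injective hh]
    · rintro rfl
      exact ⟨g, rfl, rfl⟩
  rw [FormLune, hopp, ← sdist_eq_pi_iff, hemisphere_injective.ne_iff, Ne, ← sdist_eq_zero_iff]
  obtain ⟨h0, hπ⟩ := sdist_mem_Icc g h
  exact ⟨fun hgh => ⟨h0.lt_of_ne' hgh.2.2.1, hπ.lt_of_ne hgh.2.2.2⟩,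
    fun hgh => ⟨⟨g, rfl⟩, ⟨h, rfl⟩, hgh.1.ne', hgh.2.ne⟩⟩

lemma mem_luneFace_geodesic {g u x : Sph d} (hgu : ⟪g.1, u.1⟫ = 0) {θ : ℝ} (hθ : θ ∈ Ioo 0 π) :
    x ∈ luneFace (hemisphere g) (hemisphere (geodesic g u hgu θ)) ↔
      ⟪x.1, g.1⟫ = 0 ∧ 0 ≤ ⟪x.1, u.1⟫ := by
  rw [luneFace, mem_inter_iff, mem_frontier_hemisphere, mem_hemisphere, inner_geodesic]
  refine and_congr_right fun hxg => ?_
  rw [hxg, mul_zero, zero_add, mul_nonneg_iff_of_pos_left (Real.sin_pos_of_mem_Ioo hθ)]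

lemma isCenter_luneFace_geodesic_iff {g u b : Sph d} (hgu : ⟪g.1, u.1⟫ = 0) {θ : ℝ}
    (hθ : θ ∈ Ioo 0 π) :
    IsCenter b (luneFace (hemisphere g) (hemisphere (geodesic g u hgu θ))) ↔ b = u := by
  constructor
  · rintro ⟨V, -, hbV, hface⟩
    have hmem : ∀ x : Sph d,
        x.1 ∈ V ∧ 0 ≤ ⟪x.1, b.1⟫ ↔ ⟪x.1, g.1⟫ = 0 ∧ 0 ≤ ⟪x.1, u.1⟫ := fun x => by
      rw [← mem_luneFace_geodesic hgu hθ, hface, ← mem_hemisphere]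
      rfl
    have huV : u.1 ∈ V :=
      ((hmem u).2 ⟨by rw [real_inner_comm, hgu], real_inner_self_nonneg⟩).1
    exact eq_of_forall_inner_nonneg hbV huV fun x hxV hxb => ((hmem x).1 ⟨hxV, hxb⟩).2
  · rintro rfl
    have : Fact (Module.finrank ℝ (EuclideanSpace ℝ (Fin (d + 1))) = d + 1) := ⟨by simp⟩
    refine ⟨(ℝ ∙ g.1)ᗮ, Submodule.finrank_orthogonal_span_singleton (ne_zero_of_mem_unit_sphere g),
      Submodule.mem_orthogonal_singleton_iff_inner_right.2 hgu, ext fun x => ?_⟩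
    rw [mem_luneFace_geodesic hgu hθ, ← mem_hemisphere,
      ← Submodule.mem_orthogonal_singleton_iff_inner_left]
    rfl

lemma hasThickness_hemisphere_iff {g h : Sph d} (hgh : sdist g h ∈ Ioo 0 π) {t : ℝ} :
    HasThickness (hemisphere g) (hemisphere h) t ↔ t = π - sdist g h := by
  have hhg : sdist h g ∈ Ioo 0 π := sdist_comm g h ▸ hgh
  obtain ⟨u, hgu, hu⟩ := exists_eq_geodesic hgh
  obtain ⟨v, hhv, hv⟩ := exists_eq_geodesic hhg
  have hcenter_u : ∀ b, IsCenter b (luneFace (hemisphere g) (hemisphere h)) ↔ b = u := fun b => by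
    rw [← isCenter_luneFace_geodesic_iff hgu hgh, ← hu]
  have hcenter_v : ∀ b, IsCenter b (luneFace (hemisphere h) (hemisphere g)) ↔ b = v := fun b => by
    rw [← isCenter_luneFace_geodesic_iff hhv hhg, ← hv]
  have huv : sdist u v = π - sdist g h := by
    refine sdist_eq_of_inner_eq_cos ⟨by linarith [hgh.2], by linarith [hgh.1]⟩ ?_
    have huh := inner_geodesic g u u hgu (sdist g h)
    have hug := inner_geodesic h v u hhv (sdist h g)
    rw [← hu, real_inner_comm g.1, hgu, real_inner_self_eq_norm_sq, norm_eq_of_mem_sphere] at huh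
    rw [← hv, real_inner_comm g.1, hgu, huh, sdist_comm h g] at hug
    rw [Real.cos_pi_sub]
    refine mul_left_cancel₀ (Real.sin_pos_of_mem_Ioo hgh).ne' ?_
    linarith
  simp only [HasThickness, hcenter_u, hcenter_v]
  constructor
  · rintro ⟨a, b, rfl, rfl, rfl⟩
    exact huv
  · rintro rfl
    exact ⟨u, v, rfl, rfl, huv⟩

end Lune

section Body

variable {W : Set (Sph d)} {w : ℝ}

/-- The cone spanned by the centers of the hemispheres that contain `W`. -/
noncomputable def centerCone (W : Set (Sph d)) : ProperCone ℝ (EuclideanSpace ℝ (Fin (d + 1))) :=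
  ProperCone.innerDual (Subtype.val '' W)

lemma mem_centerCone {v : EuclideanSpace ℝ (Fin (d + 1))} :
    v ∈ centerCone W ↔ ∀ x ∈ W, 0 ≤ ⟪x.1, v⟫ := by
  simp [centerCone, ProperCone.mem_innerDual]

lemma subset_hemisphere_iff {k : Sph d} : W ⊆ hemisphere k ↔ k.1 ∈ centerCone W := by
  simp only [mem_centerCone, subset_def, mem_hemisphere]

lemma mem_frontier_centerCone_iff (hW : IsClosed W) {v : EuclideanSpace ℝ (Fin (d + 1))} :
    v ∈ frontier (centerCone W : Set _) ↔
      v ∈ centerCone W ∧ ∃ x ∈ W, ⟪x.1, v⟫ = 0 := by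
  rw [centerCone, mem_frontier_innerDual_iff (hW.isCompact.image continuous_subtype_val)
    (by rintro ⟨x, -, hx⟩; exact ne_zero_of_mem_unit_sphere x hx), exists_mem_image]

lemma supports_hemisphere_iff (hW : IsClosed W) {k : Sph d} :
    Supports (hemisphere k) W ↔ k.1 ∈ frontier (centerCone W : Set _) := by
  rw [mem_frontier_centerCone_iff hW, Supports, subset_hemisphere_iff]
  constructor
  · rintro ⟨-, hk, x, hxW, hxk⟩
    exact ⟨hk, x, hW.frontier_subset hxW, mem_frontier_hemisphere.1 hxk⟩
  · rintro ⟨hk, x, hxW, hxk⟩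
    refine ⟨⟨k, rfl⟩, hk, x, ⟨subset_closure hxW, fun hint => ?_⟩, mem_frontier_hemisphere.2 hxk⟩
    exact (inner_pos_of_mem_interior_sph hint (mem_centerCone.1 hk)).ne' hxk

lemma exists_supports_eq_norm_smul (hW : IsClosed W) {v : EuclideanSpace ℝ (Fin (d + 1))}
    (hv : v ∈ frontier (centerCone W : Set _)) (hv0 : v ≠ 0) :
    ∃ k : Sph d, Supports (hemisphere k) W ∧ v = ‖v‖ • k.1 := by
  obtain ⟨k, hk⟩ := exists_eq_norm_smul_coe hv0
  have hpos : 0 < ‖v‖ := norm_pos_iff.2 hv0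
  obtain ⟨hmem, x, hxW, hxv⟩ := (mem_frontier_centerCone_iff hW).1 hv
  rw [hk, real_inner_smul_right] at hxv
  refine ⟨k, (supports_hemisphere_iff hW).2 <| (mem_frontier_centerCone_iff hW).2
    ⟨?_, x, hxW, (mul_eq_zero.1 hxv).resolve_left hpos.ne'⟩, hk⟩
  rw [(eq_inv_smul_iff₀ hpos.ne').2 hk.symm]
  exact (centerCone W).smul_mem hmem (inv_pos.2 hpos).le

lemma IsConvexBody.neg_notMem_centerCone (hW : IsConvexBody W)
    {v : EuclideanSpace ℝ (Fin (d + 1))} (hv : v ∈ centerCone W) (hv0 : v ≠ 0) :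
    -v ∉ centerCone W := fun hneg => by
  obtain ⟨k, hk⟩ := exists_eq_norm_smul_coe hv0
  obtain ⟨x, hx⟩ := hW.2.2
  have hle : ⟪x.1, k.1⟫ ≤ 0 := by
    have := mem_centerCone.1 hneg x (interior_subset hx)
    rw [inner_neg_right, hk, real_inner_smul_right] at this
    exact nonpos_of_mul_nonpos_right (neg_nonneg.1 this) (norm_pos_iff.2 hv0)
  refine hle.not_gt (inner_pos_of_mem_interior_sph hx fun y hy => ?_)
  have := mem_centerCone.1 hv y hy
  rw [hk, real_inner_smul_right] at this
  exact nonneg_of_mul_nonneg_right this (norm_pos_iff.2 hv0)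

lemma IsConvexBody.le_inner_of_forall_supports (hW : IsConvexBody W) {c : ℝ} (hc : |c| ≤ 1)
    {x y : EuclideanSpace ℝ (Fin (d + 1))} (hx : x ∈ centerCone W)
    (hle : ∀ k : Sph d, Supports (hemisphere k) W → c * ‖x‖ ≤ ⟪x, k.1⟫) (hy : y ∈ centerCone W) :
    c * (‖x‖ * ‖y‖) ≤ ⟪x, y⟫ := by
  rcases eq_or_ne x 0 with rfl | hx0
  · simp
  refine le_inner_of_forall_mem_frontier hc (hW.neg_notMem_centerCone hx hx0) (fun u hu => ?_) hy
  rcases eq_or_ne u 0 with rfl | hu0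
  · simp
  obtain ⟨k, hk, huk⟩ := exists_supports_eq_norm_smul hW.1 hu hu0
  have hmul := mul_le_mul_of_nonneg_left (hle k hk) (norm_nonneg u)
  rw [← real_inner_smul_right, ← huk] at hmul
  linarith

/-- The cone spanned by a convex body: the vectors whose direction lies in `W`. The equation
`y = ‖y‖ • a` puts `0` into the cone and makes it the projection of a closed set along the compact
factor `W`. -/
def IsConvexBody.cone (hW : IsConvexBody W) : ProperCone ℝ (EuclideanSpace ℝ (Fin (d + 1))) where
  carrier := {y | ∃ a ∈ W, y = ‖y‖ • a.1}
  add_mem' := by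
    rintro y z ⟨a, ha, hy⟩ ⟨b, hb, hz⟩
    rcases eq_or_ne (y + z) 0 with h0 | h0
    · exact ⟨a, ha, by simp [h0]⟩
    obtain ⟨x, hx⟩ := exists_eq_norm_smul_coe h0
    refine ⟨x, hW.2.1.2 a ha b hb
      ⟨‖y + z‖⁻¹ * ‖y‖, ‖y + z‖⁻¹ * ‖z‖, by positivity, by positivity, ?_⟩, hx⟩
    rwa [mul_smul, mul_smul, ← smul_add, ← hy, ← hz, eq_inv_smul_iff₀ (norm_ne_zero_iff.2 h0),
      eq_comm]
  zero_mem' := (hW.2.2.mono interior_subset).imp fun a ha => ⟨ha, by simp⟩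
  smul_mem' := by
    rintro r y ⟨a, ha, hy⟩
    refine ⟨a, ha, ?_⟩
    change (r : ℝ) • y = ‖(r : ℝ) • y‖ • a.1
    rw [norm_smul, mul_smul, ← hy, Real.norm_of_nonneg r.2]
  isClosed' := by
    have : CompactSpace W := isCompact_iff_compactSpace.1 hW.1.isCompact
    have hgraph : IsClosed {q : EuclideanSpace ℝ (Fin (d + 1)) × W | q.1 = ‖q.1‖ • q.2.1.1} :=
      isClosed_eq (by fun_prop) (by fun_prop)
    convert isClosedMap_fst_of_compactSpace _ hgraph using 1
    ext y
    simp

lemma IsConvexBody.mem_cone_iff (hW : IsConvexBody W) {y : EuclideanSpace ℝ (Fin (d + 1))} :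
    y ∈ hW.cone ↔ ∃ a ∈ W, y = ‖y‖ • a.1 :=
  Iff.rfl

lemma IsConvexBody.coe_mem_cone_iff (hW : IsConvexBody W) {x : Sph d} : x.1 ∈ hW.cone ↔ x ∈ W := by
  simp [hW.mem_cone_iff, Subtype.coe_inj]

lemma IsConvexBody.innerDual_cone (hW : IsConvexBody W) :
    ProperCone.innerDual (hW.cone : Set _) = centerCone W := by
  ext v
  rw [mem_centerCone, ProperCone.mem_innerDual]
  refine ⟨fun h x hx => h (hW.coe_mem_cone_iff.2 hx), ?_⟩
  rintro h y ⟨a, ha, hy⟩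
  rw [hy, real_inner_smul_left]
  exact mul_nonneg (norm_nonneg y) (h a ha)

lemma IsConvexBody.innerDual_centerCone (hW : IsConvexBody W) :
    ProperCone.innerDual (centerCone W : Set (EuclideanSpace ℝ (Fin (d + 1)))) = hW.cone := by
  rw [← hW.innerDual_cone, ProperCone.innerDual_innerDual]

lemma IsConvexBody.nonempty_interior_centerCone (hW : IsConvexBody W) :
    (interior (centerCone W : Set (EuclideanSpace ℝ (Fin (d + 1))))).Nonempty := by
  rw [← hW.innerDual_cone]
  refine nonempty_interior_innerDual _ ?_
  rintro y ⟨a, ha, hy⟩ ⟨b, hb, hneg⟩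
  by_contra hy0
  refine hW.2.1.1 a ha ?_
  have hba : b = -a := Subtype.ext <| smul_right_injective _ (norm_ne_zero_iff.2 hy0) <| by
    change ‖y‖ • b.1 = ‖y‖ • -a.1
    rw [smul_neg, ← hy, ← norm_neg y, ← hneg]
  exact hba ▸ hb

lemma IsConvexBody.exists_supporting_hemisphere (hW : IsConvexBody W) {p : Sph d}
    (hp : p ∈ frontier W) : ∃ G, Supports G W ∧ p ∈ frontier G := by
  have hpre : W = Subtype.val ⁻¹' (hW.cone : Set _) :=
    ext fun x => hW.coe_mem_cone_iff.symm
  have hpK := continuous_subtype_val.frontier_preimage_subset _ (hpre ▸ hp)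
  rw [mem_preimage, ← hW.innerDual_centerCone, ← innerDual_inter_sphere,
    mem_frontier_innerDual_iff ((isCompact_sphere 0 1).inter_left (centerCone W).isClosed)
      (by simp)] at hpK
  obtain ⟨-, g, ⟨hg, hg1⟩, hgp⟩ := hpK
  have hpg : p ∈ frontier (hemisphere ⟨g, hg1⟩) := by
    rw [mem_frontier_hemisphere, real_inner_comm]
    exact hgp
  exact ⟨_, ⟨⟨_, rfl⟩, subset_hemisphere_iff.2 hg, p, hp, hpg⟩, hpg⟩

lemma IsBodyOfConstantWidth.exists_sdist_eq (hW : IsBodyOfConstantWidth W w) {g : Sph d}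
    (hg : Supports (hemisphere g) W) :
    ∃ h : Sph d, Supports (hemisphere h) W ∧ sdist g h ∈ Ioo 0 π ∧ sdist g h = π - w := by
  obtain ⟨_, hh, hlune, hthick⟩ := (hW.2 _ hg).1
  obtain ⟨h, rfl⟩ := hh.1
  have hmem := formLune_hemisphere_iff.1 hlune
  have hw := (hasThickness_hemisphere_iff hmem).1 hthick
  exact ⟨h, hh, hmem, by linarith⟩

lemma IsBodyOfConstantWidth.pi_sub_mem_Ioo (hW : IsBodyOfConstantWidth W w) {G : Set (Sph d)}
    (hG : Supports G W) : π - w ∈ Ioo 0 π := by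
  obtain ⟨g, rfl⟩ := hG.1
  obtain ⟨h, -, hmem, heq⟩ := hW.exists_sdist_eq hG
  exact heq ▸ hmem

lemma IsBodyOfConstantWidth.sdist_le (hW : IsBodyOfConstantWidth W w) {g h : Sph d}
    (hg : Supports (hemisphere g) W) (hh : Supports (hemisphere h) W) :
    sdist g h ≤ π - w := by
  obtain ⟨h0, hπ⟩ := sdist_mem_Icc g h
  rcases h0.eq_or_lt with h0 | h0
  · linarith [(hW.pi_sub_mem_Ioo hg).1]
  have hlt : sdist g h < π := hπ.lt_of_ne fun heq => by
    refine hW.1.neg_notMem_centerCone (subset_hemisphere_iff.1 hg.2.1)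
      (ne_zero_of_mem_unit_sphere g) ?_
    have := subset_hemisphere_iff.1 hh.2.1
    rwa [sdist_eq_pi_iff.1 heq] at this
  have := (hW.2 _ hg).2 ⟨_, hh, formLune_hemisphere_iff.2 ⟨h0, hlt⟩,
    (hasThickness_hemisphere_iff ⟨h0, hlt⟩).2 rfl⟩
  linarith

lemma IsBodyOfConstantWidth.isConeOfConstantDiameter (hW : IsBodyOfConstantWidth W w)
    {G : Set (Sph d)} (hG : Supports G W) :
    IsConeOfConstantDiameter (centerCone W) (Real.cos (π - w)) := by
  have hc := Real.abs_cos_le_one (π - w)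
  have hsupp : ∀ {g h : Sph d}, Supports (hemisphere g) W → Supports (hemisphere h) W →
      Real.cos (π - w) ≤ ⟪g.1, h.1⟫ := fun hg hh => by
    rw [inner_eq_cos_sdist]
    exact Real.cos_le_cos_of_nonneg_of_le_pi (sdist_mem_Icc _ _).1 (hW.pi_sub_mem_Ioo hG).2.le
      (hW.sdist_le hg hh)
  refine ⟨hW.1.nonempty_interior_centerCone, fun x hx y hy => ?_, fun x hx => ?_⟩
  · refine hW.1.le_inner_of_forall_supports hc hx (fun k hk => ?_) hy
    have hkx := hW.1.le_inner_of_forall_supports hc (subset_hemisphere_iff.1 hk.2.1)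
      (fun h hh => by simpa using hsupp hk hh) hx
    rwa [norm_eq_of_mem_sphere, one_mul, real_inner_comm] at hkx
  · rcases eq_or_ne x 0 with rfl | hx0
    · obtain ⟨g, rfl⟩ := hG.1
      exact ⟨g, subset_hemisphere_iff.1 hG.2.1, norm_eq_of_mem_sphere g, by simp⟩
    · obtain ⟨k, hk, hxk⟩ := exists_supports_eq_norm_smul hW.1.1 hx hx0
      obtain ⟨h, hh, -, heq⟩ := hW.exists_sdist_eq hk
      refine ⟨h, subset_hemisphere_iff.1 hh.2.1, norm_eq_of_mem_sphere h, ?_⟩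
      rw [hxk, real_inner_smul_left, inner_eq_cos_sdist, heq, ← hxk, mul_comm]

end Body

end SphericalBody

open SphericalBody in
theorem mainTheorem4_general (d : ℕ) (W : Set (Sph d)) (w : ℝ) (hW : IsBodyOfConstantWidth W w)
    (G : Set (Sph d)) (hG : Supports G W) (p : Sph d) (hp : p ∈ W) (hpG : p ∈ frontier G) :
    ∃ H : Set (Sph d), FormLune G H ∧ W ⊆ G ∩ H ∧ HasThickness G H w ∧
      IsCenter p (luneFace G H) := by
  have hcone := hW.isConeOfConstantDiameter hG
  have hθ := hW.pi_sub_mem_Ioo hG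
  obtain ⟨g, rfl⟩ := hG.1
  have hgp : inner ℝ g.1 p.1 = 0 := by
    rw [real_inner_comm]
    exact mem_frontier_hemisphere.1 hpG
  have hdist : sdist g (geodesic g p hgp (π - w)) = π - w :=
    sdist_geodesic hgp (Set.Ioo_subset_Icc_self hθ)
  have hmem : sdist g (geodesic g p hgp (π - w)) ∈ Set.Ioo 0 π := by rwa [hdist]
  have hsubset : W ⊆ hemisphere (geodesic g p hgp (π - w)) := by
    refine subset_hemisphere_iff.2 (hcone.smul_add_smul_mem (Real.sin_pos_of_mem_Ioo hθ)
      (Real.cos_sq_add_sin_sq _) (subset_hemisphere_iff.1 hG.2.1) (norm_eq_of_mem_sphere g) ?_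
      (norm_eq_of_mem_sphere p) hgp)
    rw [hW.1.innerDual_centerCone]
    exact hW.1.coe_mem_cone_iff.2 hp
  exact ⟨hemisphere (geodesic g p hgp (π - w)), formLune_hemisphere_iff.2 hmem,
    Set.subset_inter hG.2.1 hsubset,
    (hasThickness_hemisphere_iff hmem).2 (by rw [hdist, sub_sub_cancel]),
    (isCenter_luneFace_geodesic_iff hgp hθ).2 rfl⟩

theorem mainTheorem4 (d : ℕ) (hd : 2 ≤ d) (W : Set (SphericalBody.Sph d)) (w : ℝ)
    (hW : SphericalBody.IsBodyOfConstantWidth W w)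
    (p : SphericalBody.Sph d) (hp : p ∈ frontier W) :
    ∃ G H : Set (SphericalBody.Sph d),
      SphericalBody.FormLune G H ∧ W ⊆ G ∩ H ∧ SphericalBody.HasThickness G H w ∧
        (SphericalBody.IsCenter p (SphericalBody.luneFace G H) ∨
          SphericalBody.IsCenter p (SphericalBody.luneFace H G)) := by
  obtain ⟨G, hG, hpG⟩ := hW.1.exists_supporting_hemisphere hp
  obtain ⟨H, hlune, hWGH, hthick, hcenter⟩ :=
    mainTheorem4_general d W w hW G hG p (hW.1.1.frontier_subset hp) hpG
  exact ⟨G, H, hlune, hWGH, hthick, Or.inl hcenter⟩
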